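/- There is an absolute constant $c>0$ such that the following holds. Let $n,k,\Delta_1,\Delta_2\ge 0$ be integers with $\Delta_1\le n$, $\Delta_2\le k$ and $n-\Delta_1=k-\Delta_2$, and put $\Delta=\Delta_1+\Delta_2$. In online (rooted) Steiner tree with predictions, a finite connected undirected graph with positive edge costs, a root $\rho$ and a predicted set of vertices $\hat R$ are given offline; distinct vertices (the requests, forming a set $R$) arrive one per step, and the algorithm must irrevocably buy edges so that after every step all requests that have arrived are connected to $\rho$ by bought edges. Its cost is the total cost of the bought edges, and $\mathrm{OPT}(R)$ is the minimum cost of a set of edges that connects all of $R$ to $\rho$. Then there are a graph, edge costs and a root as above, a fixed prediction $\hat R$ with $|\hat R|=n$, and an oblivious adversary, that is, a probability distribution on request sequences, chosen independently of the algorithm, such that always $|R|=k$, $|\hat R\setminus R|=\Delta_1$, $|R\setminus\hat R|=\Delta_2$ and, if $k\ge 1$, $\mathrm{OPT}(R)>0$, such that every randomized online algorithm $\mathrm{ALG}$ (which may depend on the graph, the edge costs, the root, $\hat R$ and the distribution) satisfies $$\mathbb E[\mathrm{ALG}]\;\ge\; c\,\log\bigl(\min(k,\Delta)\bigr)\cdot\mathbb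 E[\mathrm{OPT}(R)],$$ where the expectation is over both the requests and the algorithm's random choices, and where $\log(\min(k,\Delta))$ is read as $0$ if $\min(k,\Delta)=0$. That is, against this adversary every randomized algorithm has competitive ratio $\Omega(\log\min(k,\Delta))$. -/

import Mathlib

open MeasureTheory

universe u

noncomputable section

/-- An offline-known rooted Steiner tree instance: a connected undirected graph with positive
edge costs and a root. -/
structure SteinerInstance (V : Type) where
  graph : SimpleGraph V
  connected : graph.Connected
  root : V
  cost : Sym2 V → ℝ
  cost_pos : ∀ e ∈ graph.edgeSet, 0 < cost e

namespace SteinerInstance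

variable {V : Type}

/-- The total cost of a set of edges. -/
def totalCost (I : SteinerInstance V) (S : Finset (Sym2 V)) : ℝ := ∑ e ∈ S, I.cost e

/-- The edge set `S` of the graph connects the terminal `r` to the root. -/
def Connects (I : SteinerInstance V) (S : Finset (Sym2 V)) (r : V) : Prop :=
  (SimpleGraph.fromEdgeSet (S : Set (Sym2 V))).Reachable I.root r

/-- `S` is a set of edges of the graph that connects every terminal in `R` to the root. -/
def Feasible (I : SteinerInstance V) (S : Finset (Sym2 V)) (R : Finset V) : Prop :=
  (S : Set (Sym2 V)) ⊆ I.graph.edgeSet ∧ ∀ r ∈ R, I.Connects S r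

/-- The optimal offline cost for the terminal set `R`. -/
def opt (I : SteinerInstance V) (R : Finset V) : ℝ :=
  sInf {x : ℝ | ∃ S : Finset (Sym2 V), I.Feasible S R ∧ x = I.totalCost S}

end SteinerInstance

/-- A deterministic online algorithm on a given instance. Since the instance and the prediction
are given offline, the algorithm may depend on both of them arbitrarily. `sol σ` is the set of
edges bought once the requests of `σ` have arrived, in the order of the list; `sol []` is what is
bought before the first request. -/
structure OnlineAlgorithm {V : Type} [DecidableEq V] (I : SteinerInstance V) where
  sol : List V → Finset (Sym2 V)
  /-- Purchases are irrevocable. -/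
  mono : ∀ σ τ : List V, σ <+: τ → sol σ ⊆ sol τ
  /-- All requests that have arrived are connected to the root. -/
  feasible : ∀ σ : List V, I.Feasible (sol σ) σ.toFinset

/-- A randomized online algorithm: a random choice of a deterministic one, on an arbitrary
probability space. -/
structure RandomizedAlgorithm {V : Type} [DecidableEq V] (I : SteinerInstance V) where
  Seed : Type u
  [measurableSpace : MeasurableSpace Seed]
  law : Measure Seed
  [isProbabilityMeasure : IsProbabilityMeasure law]
  alg : Seed → OnlineAlgorithm I
  measurable : ∀ (σ : List V) (S : Finset (Sym2 V)), MeasurableSet {s | (alg s).sol σ = S}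

/-- The expected cost of a randomized algorithm on the request sequence `σ`. -/
def RandomizedAlgorithm.expectedCost {V : Type} [DecidableEq V] {I : SteinerInstance V}
    (A : RandomizedAlgorithm.{u} I) (σ : List V) : ℝ :=
  letI := A.measurableSpace
  ∫ s, I.totalCost ((A.alg s).sol σ) ∂A.law

/-- An oblivious `(n, k, Δ₁, Δ₂)`-adversary: it fixes a prediction of `n` vertices, and draws a
sequence of `k` distinct requests (independently of the algorithm's random choices) such that the
numbers of predicted vertices that are not requested, and of requested vertices that are not
predicted, are always `Δ₁` and `Δ₂`. -/
structure Adversary (V : Type) [DecidableEq V] (n k Δ₁ Δ₂ : ℕ) where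
  prediction : Finset V
  requests : PMF (List V)
  card_prediction : prediction.card = n
  nodup : ∀ σ ∈ requests.support, σ.Nodup
  length_requests : ∀ σ ∈ requests.support, σ.length = k
  card_sdiff_requests : ∀ σ ∈ requests.support, (prediction \ σ.toFinset).card = Δ₁
  card_requests_sdiff : ∀ σ ∈ requests.support, (σ.toFinset \ prediction).card = Δ₂

/-- The expectation of `f σ` over the random request sequence `σ`. On a finite vertex set only
finitely many sequences have positive probability, so this is a finite sum. -/
def Adversary.expect {V : Type} [DecidableEq V] {n k Δ₁ Δ₂ : ℕ}
    (adv : Adversary V n k Δ₁ Δ₂) (f : List V → ℝ) : ℝ :=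
  ∑' σ : List V, (adv.requests σ).toReal * f σ

end

/-! The hard instance is the diamond graph. Its far end lies `2 ^ h` unit edges from the root, and
at each of `h` levels a path chooses between two midpoints, one bit of its label `w` serving all
segments of that level. The adversary draws `w` uniformly and requests the vertices of its path from
coarse to fine.

Requests at multiples of `2 ^ t` reveal only the bits of `w` from `t` on (`vert_eq_of_agreeFrom`),
yet cuts around the odd multiples of `2 ^ t` force at least `2 ^ h / 2` edges consistent with these
bits (`two_pow_le_card_agreeFrom`). The next bit is still a fair coin, so on average half of the
consistent edges become inconsistent (`sum_card_disagree`). Edges lost at different levels are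
distinct, so every level wastes `2 ^ h / 4` (`le_sum_card_of_revealed`), while the path itself costs
`2 ^ h`. Averaging over seeds covers randomized algorithms.

Cheap leaves at the root pad all cardinalities. The non-root vertices of the diamond lie either all
outside the prediction or all inside it, so the prediction says nothing about `w`. The first needs
`2 ^ h ≤ Δ₂`, the second room for about `4 ^ h` wrong predictions and `2 ^ h` correct ones; one of
the two always allows `h` of order `log (min k Δ)`. -/

noncomputable section

/-! ### Labels and vertices of the diamond graph -/

/-- Two labels agree on all bits of index at least `t`. -/
def AgreeFrom {h : ℕ} (t : ℕ) (v w : Fin h → Bool) : Prop := ∀ j : Fin h, t ≤ j.val → v j = w j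

instance {h : ℕ} (t : ℕ) (v w : Fin h → Bool) : Decidable (AgreeFrom t v w) := by
  unfold AgreeFrom; infer_instance

/-- The vertices of the diamond graph of depth `h`: a position and a label, whose bit `j` may be
set only at positions that are not multiples of `2 ^ (j + 1)`. -/
abbrev DiamondVertex (h : ℕ) : Type :=
  {p : Fin (2 ^ h + 1) × (Fin h → Bool) // ∀ j, p.2 j = true → ¬ 2 ^ (j.val + 1) ∣ p.1.val}

namespace DiamondVertex

variable {h : ℕ}

/-- The vertex at position `a` on the path with label `w`. -/
def vert (a : Fin (2 ^ h + 1)) (w : Fin h → Bool) : DiamondVertex h :=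
  ⟨(a, fun j => w j && !decide (2 ^ (j.val + 1) ∣ a.val)), by intro j; simp⟩

/-- The root of the diamond graph. -/
def root (h : ℕ) : DiamondVertex h := vert 0 (fun _ => false)

theorem vert_zero (w : Fin h → Bool) : vert 0 w = root h := by
  simp [root, vert]

@[simp] theorem vert_pos (a : Fin (2 ^ h + 1)) (w : Fin h → Bool) : (vert a w).1.1 = a := rfl

theorem vert_label (a : Fin (2 ^ h + 1)) (w : Fin h → Bool) (j : Fin h)
    (hj : ¬ 2 ^ (j.val + 1) ∣ a.val) : (vert a w).1.2 j = w j := by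
  simp [vert, hj]

theorem vert_self (x : DiamondVertex h) : vert x.1.1 x.1.2 = x := by
  obtain ⟨⟨a, w⟩, hx⟩ := x
  simp only [vert, Subtype.mk.injEq, Prod.mk.injEq, true_and]
  funext j
  have := hx j
  cases hw : w j <;> simp_all

/-- Bits below `t` are masked at multiples of `2 ^ t`. This is what hides the low bits of the random
label from the algorithm. -/
theorem vert_eq_of_agreeFrom {t : ℕ} {a : Fin (2 ^ h + 1)} {v w : Fin h → Bool}
    (ha : 2 ^ t ∣ a.val) (hvw : AgreeFrom t v w) : vert a v = vert a w := by
  simp only [vert, Subtype.mk.injEq, Prod.mk.injEq, true_and]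
  funext j
  by_cases hj : t ≤ j.val
  · rw [hvw j hj]
  · have : 2 ^ (j.val + 1) ∣ a.val := (pow_dvd_pow 2 (by omega)).trans ha
    simp [this]

theorem vert_injective (w : Fin h → Bool) : Function.Injective (fun a => vert a w) := by
  intro a b hab
  exact congrArg (fun x : DiamondVertex h => x.1.1) hab

theorem vert_ne_root {a : Fin (2 ^ h + 1)} (ha : a ≠ 0) (w : Fin h → Bool) :
    vert a w ≠ root h := by
  intro hab
  exact ha (congrArg (fun x : DiamondVertex h => x.1.1) hab)

theorem card_le : Fintype.card (DiamondVertex h) ≤ (2 ^ h + 1) * 2 ^ h := by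
  refine (Fintype.card_subtype_le _).trans ?_
  simp

end DiamondVertex

open DiamondVertex

/-! ### Positions near odd multiples of a power of two -/

/-- Positions at distance less than `2 ^ t` from an odd multiple of `2 ^ t` are not divisible by
higher powers of two. -/
theorem not_pow_dvd_of_near {t j u a b : ℕ} (ha : a = 2 ^ t * (2 * u + 1)) (h1 : b < a + 2 ^ t)
    (h2 : a < b + 2 ^ t) (hj : t ≤ j) : ¬ 2 ^ (j + 1) ∣ b := by
  intro hb
  -- Already `2 ^ (t + 1) ∣ b` is impossible: even and odd multiples of `2 ^ t` are at least `2 ^ t`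
  -- apart.
  obtain ⟨m, rfl⟩ := (pow_dvd_pow 2 (show t + 1 ≤ j + 1 by omega)).trans hb
  rw [pow_succ] at h1 h2
  generalize 2 ^ t = T at *
  rcases le_or_gt m u with hm | hm
  · have := Nat.mul_le_mul_left T hm
    nlinarith
  · have := Nat.mul_le_mul_left T (Nat.succ_le_of_lt hm)
    rw [Nat.mul_succ] at this
    nlinarith

/-- A position determines the odd multiple of `T` that it is near to. -/
theorem eq_of_near_odd_multiples {T p u u' d d' : ℕ} (hd : d < T) (hd' : d' < T)
    (h1 : p + (d + 1) = T * (2 * u + 1) ∨ p + 1 = T * (2 * u + 1) + (d + 1))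
    (h2 : p + (d' + 1) = T * (2 * u' + 1) ∨ p + 1 = T * (2 * u' + 1) + (d' + 1)) : u = u' := by
  -- Each hypothesis places `p` in the block from `2 * u * T` to `2 * (u + 1) * T - 1`, and these
  -- blocks are disjoint.
  rw [Nat.mul_add, Nat.mul_left_comm] at h1 h2
  rcases lt_trichotomy u u' with hlt | heq | hlt
  · have := Nat.mul_le_mul_left T (Nat.succ_le_of_lt hlt)
    rw [Nat.mul_succ] at this
    omega
  · exact heq
  · have := Nat.mul_le_mul_left T (Nat.succ_le_of_lt hlt)
    rw [Nat.mul_succ] at this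
    omega

/-! ### The diamond instance and its cuts -/

section Graph

variable {h : ℕ} {P : Type}

/-- The edge of the diamond graph at position `q.1` of the path with label `q.2`. -/
def diamondEdge (P : Type) (q : Fin (2 ^ h) × (Fin h → Bool)) : Sym2 (DiamondVertex h ⊕ P) :=
  s(.inl (vert q.1.castSucc q.2), .inl (vert q.1.succ q.2))

/-- The edge from the root to the additional leaf `x`. -/
def leafEdge (h : ℕ) (x : P) : Sym2 (DiamondVertex h ⊕ P) := s(.inl (root h), .inr x)

/-- One end of every edge has an odd position, where no bit of the label is masked. -/
theorem diamondEdge_injective : Function.Injective (diamondEdge (h := h) P) := by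
  rintro ⟨p, v⟩ ⟨q, w⟩ heq
  simp only [diamondEdge, Sym2.eq_iff, Sum.inl.injEq] at heq
  have key : p = q ∧ vert p.castSucc v = vert q.castSucc w ∧ vert p.succ v = vert q.succ w := by
    rcases heq with ⟨h1, h2⟩ | ⟨h1, h2⟩
    · have := congrArg (fun x : DiamondVertex h => x.1.1.val) h1
      simp only [vert_pos, Fin.val_castSucc] at this
      exact ⟨Fin.ext this, h1, h2⟩
    · have h3 := congrArg (fun x : DiamondVertex h => x.1.1.val) h1
      have h4 := congrArg (fun x : DiamondVertex h => x.1.1.val) h2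
      simp only [vert_pos, Fin.val_castSucc, Fin.val_succ] at h3 h4
      omega
  obtain ⟨rfl, h1, h2⟩ := key
  refine Prod.ext rfl (funext fun j => ?_)
  have hodd : ∀ x : ℕ, ¬ 2 ∣ x → ¬ 2 ^ (j.val + 1) ∣ x := fun x hx hd =>
    hx ((dvd_pow_self 2 (Nat.succ_ne_zero _)).trans hd)
  change v j = w j
  by_cases hp : 2 ∣ p.val
  · have hs := hodd p.succ.val (by rw [Fin.val_succ]; omega)
    rw [← vert_label p.succ v j hs, ← vert_label p.succ w j hs, h2]
  · have hs := hodd p.castSucc.val (by rwa [Fin.val_castSucc])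
    rw [← vert_label p.castSucc v j hs, ← vert_label p.castSucc w j hs, h1]

theorem leafEdge_injective : Function.Injective (leafEdge h (P := P)) := by
  intro x y hxy
  simpa [leafEdge] using hxy

theorem leafEdge_ne_diamondEdge (x : P) (q : Fin (2 ^ h) × (Fin h → Bool)) :
    leafEdge h x ≠ diamondEdge P q := by
  simp [leafEdge, diamondEdge]

/-- The diamond graph of depth `h` with additional leaves attached to its root. -/
def diamondGraph (h : ℕ) (P : Type) : SimpleGraph (DiamondVertex h ⊕ P) :=
  SimpleGraph.fromEdgeSet (Set.range (diamondEdge P) ∪ Set.range (leafEdge h))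

theorem diamondEdge_mem (q : Fin (2 ^ h) × (Fin h → Bool)) :
    diamondEdge P q ∈ (diamondGraph h P).edgeSet := by
  rw [diamondGraph, SimpleGraph.edgeSet_fromEdgeSet]
  refine ⟨Or.inl ⟨q, rfl⟩, ?_⟩
  intro hd
  have hd' : vert q.1.castSucc q.2 = vert q.1.succ q.2 := by
    simpa [diamondEdge] using hd
  have := congrArg (fun x : DiamondVertex h => x.1.1.val) hd'
  simp at this

theorem leafEdge_mem (x : P) : leafEdge h x ∈ (diamondGraph h P).edgeSet := by
  rw [diamondGraph, SimpleGraph.edgeSet_fromEdgeSet]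
  exact ⟨Or.inr ⟨x, rfl⟩, by simp [leafEdge]⟩

theorem mem_edgeSet_cases {e : Sym2 (DiamondVertex h ⊕ P)} (he : e ∈ (diamondGraph h P).edgeSet) :
    (∃ q, diamondEdge P q = e) ∨ ∃ x, leafEdge h x = e := by
  rw [diamondGraph, SimpleGraph.edgeSet_fromEdgeSet] at he
  exact he.1

/-- A set that contains the path with label `w` connects the root to its vertices. -/
theorem reachable_vert {E : Set (Sym2 (DiamondVertex h ⊕ P))} {w : Fin h → Bool}
    (hE : ∀ p, diamondEdge P (p, w) ∈ E) (a : Fin (2 ^ h + 1)) :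
    (SimpleGraph.fromEdgeSet E).Reachable (.inl (root h)) (.inl (vert a w)) := by
  induction a using Fin.induction with
  | zero => rw [vert_zero]
  | succ p ih =>
    refine ih.trans (SimpleGraph.Adj.reachable ?_)
    rw [SimpleGraph.fromEdgeSet_adj]
    refine ⟨hE p, fun heq => ?_⟩
    have := congrArg (fun x : DiamondVertex h => x.1.1.val) (Sum.inl_injective heq)
    simp at this

theorem reachable_leaf {E : Set (Sym2 (DiamondVertex h ⊕ P))} {x : P} (hE : leafEdge h x ∈ E) :
    (SimpleGraph.fromEdgeSet E).Reachable (.inl (root h)) (.inr x) := by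
  refine SimpleGraph.Adj.reachable ?_
  rw [SimpleGraph.fromEdgeSet_adj]
  exact ⟨hE, by simp⟩

theorem diamondGraph_connected : (diamondGraph h P).Connected := by
  have hr : ∀ y, (diamondGraph h P).Reachable (.inl (root h)) y := by
    rintro (x | x)
    · rw [← vert_self x]
      exact reachable_vert (fun p => Or.inl ⟨_, rfl⟩) _
    · exact reachable_leaf (Or.inr ⟨_, rfl⟩)
  have : Nonempty (DiamondVertex h ⊕ P) := ⟨.inl (root h)⟩
  exact ⟨fun x y => (hr x).symm.trans (hr y)⟩

open Classical in
/-- The instance on the diamond graph: the edges of the diamond cost `1`, and all the additional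
leaves together cost less than `1`. -/
def diamondInstance (h : ℕ) (P : Type) [Fintype P] : SteinerInstance (DiamondVertex h ⊕ P) where
  graph := diamondGraph h P
  connected := diamondGraph_connected
  root := .inl (root h)
  cost e := if e ∈ Set.range (diamondEdge P) then 1 else 1 / (Fintype.card P + 1 : ℝ)
  cost_pos e _ := by split_ifs <;> positivity

open Classical in
/-- The edges of the diamond in `S`, by position and label. -/
def diamondPart (S : Finset (Sym2 (DiamondVertex h ⊕ P))) :
    Finset (Fin (2 ^ h) × (Fin h → Bool)) :=
  Finset.univ.filter fun q => diamondEdge P q ∈ S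

theorem mem_diamondPart {S : Finset (Sym2 (DiamondVertex h ⊕ P))}
    {q : Fin (2 ^ h) × (Fin h → Bool)} : q ∈ diamondPart S ↔ diamondEdge P q ∈ S := by
  simp [diamondPart]

variable [Fintype P]

theorem cost_diamondEdge (q : Fin (2 ^ h) × (Fin h → Bool)) :
    (diamondInstance h P).cost (diamondEdge P q) = 1 := by
  simp [diamondInstance]

theorem cost_leafEdge (x : P) :
    (diamondInstance h P).cost (leafEdge h x) = 1 / (Fintype.card P + 1 : ℝ) := by
  have : ¬ ∃ q, diamondEdge P q = leafEdge h x := fun ⟨q, hq⟩ => leafEdge_ne_diamondEdge x q hq.symm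
  simp [diamondInstance, Set.mem_range, -Prod.exists, this]

theorem le_cost (e : Sym2 (DiamondVertex h ⊕ P)) :
    1 / (Fintype.card P + 1 : ℝ) ≤ (diamondInstance h P).cost e := by
  unfold diamondInstance
  dsimp only
  split_ifs
  · rw [div_le_one (by positivity)]
    linarith [Nat.cast_nonneg (α := ℝ) (Fintype.card P)]
  · exact le_rfl

theorem cost_nonneg (e : Sym2 (DiamondVertex h ⊕ P)) : 0 ≤ (diamondInstance h P).cost e :=
  le_trans (by positivity) (le_cost e)

theorem card_diamondPart_le (S : Finset (Sym2 (DiamondVertex h ⊕ P))) :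
    ((diamondPart S).card : ℝ) ≤ (diamondInstance h P).totalCost S := by
  have hsub : (diamondPart S).map ⟨_, diamondEdge_injective⟩ ⊆ S := by
    intro e he
    obtain ⟨q, hq, rfl⟩ := Finset.mem_map.1 he
    exact mem_diamondPart.1 hq
  calc ((diamondPart S).card : ℝ)
      = ∑ e ∈ (diamondPart S).map ⟨_, diamondEdge_injective⟩, (diamondInstance h P).cost e := by
        rw [Finset.sum_map]
        simp [cost_diamondEdge]
    _ ≤ (diamondInstance h P).totalCost S :=
        Finset.sum_le_sum_of_subset_of_nonneg hsub fun e _ _ => cost_nonneg e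

/-- A set that connects an odd multiple of `2 ^ t` on the path of `w` to the root contains, at each
distance up to `2 ^ t`, an edge whose label agrees with `w` from bit `t` on. -/
theorem exists_diamondEdge_of_connects {S : Finset (Sym2 (DiamondVertex h ⊕ P))}
    (hS : (S : Set (Sym2 (DiamondVertex h ⊕ P))) ⊆ (diamondGraph h P).edgeSet)
    {t u d : ℕ} {a : Fin (2 ^ h + 1)} {w : Fin h → Bool} (ha : a.val = 2 ^ t * (2 * u + 1))
    (hd : 1 ≤ d) (hdt : d ≤ 2 ^ t) (hc : (diamondInstance h P).Connects S (.inl (vert a w))) :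
    ∃ q ∈ diamondPart S, AgreeFrom t q.2 w ∧
      (q.1.val + d = a.val ∨ q.1.val + 1 = a.val + d) := by
  -- The cut: an open ball of radius `d` around position `a`, restricted to labels that agree with
  -- `w` from bit `t` on. An edge leaving it must change position across the boundary, since bits
  -- from `t` on are never masked inside.
  let U : Set (DiamondVertex h ⊕ P) :=
    {y | ∃ x : DiamondVertex h, y = .inl x ∧ x.1.1.val < a.val + d ∧ a.val < x.1.1.val + d ∧
      AgreeFrom t x.1.2 w}
  have hat : 2 ^ t ≤ a.val := by rw [ha]; exact Nat.le_mul_of_pos_right _ (by omega)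
  have hvis : ∀ b : ℕ, b < a.val + d → a.val < b + d → ∀ j, t ≤ j → ¬ 2 ^ (j + 1) ∣ b :=
    fun b h1 h2 j hj => not_pow_dvd_of_near ha (by omega) (by omega) hj
  have hvert : ∀ (b : Fin (2 ^ h + 1)) (v : Fin h → Bool),
      (.inl (vert b v) : DiamondVertex h ⊕ P) ∈ U ↔
        b.val < a.val + d ∧ a.val < b.val + d ∧ AgreeFrom t v w := by
    intro b v
    constructor
    · rintro ⟨x, hx, h1, h2, h3⟩
      obtain rfl := Sum.inl_injective hx
      refine ⟨h1, h2, fun j hj => ?_⟩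
      rw [← h3 j hj, vert_label b v j (hvis _ h1 h2 j hj)]
    · rintro ⟨h1, h2, h3⟩
      refine ⟨_, rfl, h1, h2, fun j hj => ?_⟩
      rw [← h3 j hj, vert_label b v j (hvis _ h1 h2 j hj)]
  have hin : (.inl (vert a w) : DiamondVertex h ⊕ P) ∈ U :=
    (hvert a w).2 ⟨by omega, by omega, fun _ _ => rfl⟩
  have hroot : (.inl (root h) : DiamondVertex h ⊕ P) ∉ U := by
    rw [root, hvert]
    rintro ⟨-, h2, -⟩
    simp only [Fin.val_zero] at h2
    omega
  obtain ⟨walk⟩ := hc.symm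
  obtain ⟨dart, -, h1, h2⟩ := walk.exists_boundary_dart U hin hroot
  have hadj := dart.adj
  rw [SimpleGraph.fromEdgeSet_adj] at hadj
  have hmem : s(dart.fst, dart.snd) ∈ S := hadj.1
  rcases mem_edgeSet_cases (hS hmem) with ⟨q, hq⟩ | ⟨x, hx⟩
  · refine ⟨q, mem_diamondPart.2 (hq ▸ hmem), ?_⟩
    rw [diamondEdge, Sym2.eq_iff] at hq
    have hpos : q.1.castSucc.val = q.1.val := rfl
    have hpos' : q.1.succ.val = q.1.val + 1 := Fin.val_succ _
    rcases hq with ⟨h3, h4⟩ | ⟨h3, h4⟩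
    · rw [← h3, hvert] at h1
      rw [← h4, hvert] at h2
      refine ⟨h1.2.2, ?_⟩
      by_contra hcon
      exact h2 ⟨by omega, by omega, h1.2.2⟩
    · rw [← h4, hvert] at h1
      rw [← h3, hvert] at h2
      refine ⟨h1.2.2, ?_⟩
      by_contra hcon
      exact h2 ⟨by omega, by omega, h1.2.2⟩
  · exfalso
    have hr : (.inr x : DiamondVertex h ⊕ P) ∉ U := by
      rintro ⟨y, hy, -⟩
      exact absurd hy (by simp)
    rw [leafEdge, Sym2.eq_iff] at hx
    rcases hx with ⟨h3, h4⟩ | ⟨h3, h4⟩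
    · exact hroot (h3 ▸ h1)
    · exact hr (h4 ▸ h1)

/-- A set that connects all multiples of `2 ^ t` on the path of `w` to the root contains at least
`2 ^ h / 2` edges whose label agrees with `w` from bit `t` on. -/
theorem two_pow_le_card_agreeFrom {S : Finset (Sym2 (DiamondVertex h ⊕ P))}
    (hS : (S : Set (Sym2 (DiamondVertex h ⊕ P))) ⊆ (diamondGraph h P).edgeSet)
    {t : ℕ} (ht : t ≤ h) {w : Fin h → Bool}
    (hc : ∀ a : Fin (2 ^ h + 1), a ≠ 0 → 2 ^ t ∣ a.val →
      (diamondInstance h P).Connects S (.inl (vert a w))) :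
    2 ^ h ≤ 2 * ((diamondPart S).filter fun q => AgreeFrom t q.2 w).card := by
  have hlt : ∀ u : Fin (2 ^ (h - t - 1)), 2 ^ t * (2 * u.val + 1) < 2 ^ h + 1 := by
    intro u
    have hu : 2 * u.val + 1 ≤ 2 ^ (h - t) := by
      have := u.2
      rcases Nat.eq_zero_or_pos (h - t) with h0 | h0
      · simp only [h0, Nat.zero_sub, pow_zero] at this ⊢
        omega
      · have : 2 ^ (h - t) = 2 * 2 ^ (h - t - 1) := by rw [← pow_succ']; congr 1; omega
        omega
    calc 2 ^ t * (2 * u.val + 1) ≤ 2 ^ t * 2 ^ (h - t) := Nat.mul_le_mul_left _ hu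
      _ = 2 ^ h := by rw [← pow_add]; congr 1; omega
      _ < 2 ^ h + 1 := Nat.lt_succ_self _
  -- One edge for each pair of an odd multiple of `2 ^ t` and a distance; its position determines
  -- the pair.
  have hex : ∀ x : Fin (2 ^ (h - t - 1)) × Fin (2 ^ t), ∃ q ∈ diamondPart S, AgreeFrom t q.2 w ∧
      (q.1.val + (x.2.val + 1) = 2 ^ t * (2 * x.1.val + 1) ∨
        q.1.val + 1 = 2 ^ t * (2 * x.1.val + 1) + (x.2.val + 1)) := by
    intro x
    have hx := hlt x.1
    refine exists_diamondEdge_of_connects hS (u := x.1.val) (d := x.2.val + 1)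
      (a := ⟨2 ^ t * (2 * x.1.val + 1), hx⟩) rfl (by omega) (by have := x.2.2; omega)
      (hc _ ?_ (Dvd.intro _ rfl))
    intro h0
    have := congrArg Fin.val h0
    simp at this
  choose f hf hag hpos using hex
  have hinj : Function.Injective f := by
    rintro ⟨u, d⟩ ⟨u', d'⟩ heq
    have h1 := hpos (u, d)
    have h2 := hpos (u', d')
    rw [heq] at h1
    generalize (f (u', d')).1.val = p at h1 h2
    have hd := d.2
    have hd' := d'.2
    dsimp only at h1 h2
    have huu : u.val = u'.val := eq_of_near_odd_multiples hd hd' h1 h2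
    rw [huu] at h1
    exact Prod.ext (Fin.ext huu) (Fin.ext (by dsimp only; omega))
  have hcard : 2 ^ (h - t - 1) * 2 ^ t ≤
      ((diamondPart S).filter fun q => AgreeFrom t q.2 w).card := by
    have := Finset.card_le_card_of_injOn (s := Finset.univ)
      (t := (diamondPart S).filter fun q => AgreeFrom t q.2 w) f
      (fun x _ => by simp [hf x, hag x]) hinj.injOn
    simpa using this
  -- An inequality because for `t = h` the truncated exponent `h - t - 1` is `0`.
  calc 2 ^ h ≤ 2 ^ (h - t - 1 + t + 1) := Nat.pow_le_pow_right (by norm_num) (by omega)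
    _ = 2 * (2 ^ (h - t - 1) * 2 ^ t) := by rw [pow_succ', pow_add]
    _ ≤ _ := Nat.mul_le_mul_left _ hcard

end Graph

/-! ### Averaging over the unrevealed bits -/

section Flip

variable {h : ℕ} {X : Type}

theorem AgreeFrom.succ_iff {t : ℕ} (ht : t < h) {v w : Fin h → Bool} :
    AgreeFrom t v w ↔ AgreeFrom (t + 1) v w ∧ v ⟨t, ht⟩ = w ⟨t, ht⟩ := by
  constructor
  · exact fun hvw => ⟨fun j hj => hvw j (by omega), hvw _ le_rfl⟩
  · rintro ⟨h1, h2⟩ j hj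
    rcases Nat.eq_or_lt_of_le hj with heq | hlt
    · obtain rfl : j = ⟨t, ht⟩ := Fin.ext heq.symm
      exact h2
    · exact h1 j hlt

/-- If the sets `T w` do not depend on bit `t` of `w`, then on average half of their elements that
agree with `w` above `t` disagree with `w` at `t`. -/
theorem sum_card_disagree {t : ℕ} (ht : t < h)
    (T : (Fin h → Bool) → Finset (X × (Fin h → Bool)))
    (hT : ∀ v w, AgreeFrom (t + 1) v w → T v = T w) :
    ∑ w, ((T w).filter fun q => AgreeFrom (t + 1) q.2 w).card =
      2 * ∑ w, ((T w).filter fun q =>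
        AgreeFrom (t + 1) q.2 w ∧ ¬ q.2 ⟨t, ht⟩ = w ⟨t, ht⟩).card := by
  let flip : (Fin h → Bool) → (Fin h → Bool) :=
    fun w => Function.update w ⟨t, ht⟩ (!w ⟨t, ht⟩)
  have hinv : Function.Involutive flip := by
    intro w
    simp [flip]
  have hflip : ∀ w, AgreeFrom (t + 1) (flip w) w := by
    intro w j hj
    have : j ≠ ⟨t, ht⟩ := fun h0 => by rw [h0] at hj; simp at hj
    simp [flip, this]
  have hagree : ∀ v w, AgreeFrom (t + 1) v (flip w) ↔ AgreeFrom (t + 1) v w := fun v w =>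
    ⟨fun hv j hj => (hv j hj).trans (hflip w j hj),
      fun hv j hj => (hv j hj).trans (hflip w j hj).symm⟩
  -- Flipping bit `t` of `w` preserves `T w` and exchanges agreement with disagreement at `t`.
  have hswap : ∑ w, ((T w).filter fun q =>
        AgreeFrom (t + 1) q.2 w ∧ q.2 ⟨t, ht⟩ = w ⟨t, ht⟩).card =
      ∑ w, ((T w).filter fun q =>
        AgreeFrom (t + 1) q.2 w ∧ ¬ q.2 ⟨t, ht⟩ = w ⟨t, ht⟩).card := by
    rw [← Equiv.sum_comp hinv.toPerm]
    refine Finset.sum_congr rfl fun w _ => ?_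
    rw [Function.Involutive.coe_toPerm, hT _ _ (hflip w)]
    congr 1
    refine Finset.filter_congr fun q _ => ?_
    rw [hagree]
    simp only [flip, Function.update_self]
    cases q.2 ⟨t, ht⟩ <;> cases w ⟨t, ht⟩ <;> simp
  rw [two_mul]
  nth_rewrite 1 [← hswap]
  rw [← Finset.sum_add_distrib]
  refine Finset.sum_congr rfl fun w _ => ?_
  rw [← Finset.filter_filter, ← Finset.filter_filter, Finset.card_filter_add_card_filter_not]

/-- A family of growing sets `T t w` such that `T t w` depends only on the bits of `w` from `t` on
and has at least `m / 2` elements that agree with `w` on these bits, has on average at least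
`(h + 2) m / 4` elements at the end. -/
theorem le_sum_card_of_revealed {m : ℕ}
    (T : ℕ → (Fin h → Bool) → Finset (X × (Fin h → Bool)))
    (hmono : ∀ t w, T (t + 1) w ⊆ T t w)
    (hT : ∀ t ≤ h, ∀ v w, AgreeFrom t v w → T t v = T t w)
    (hcard : ∀ t ≤ h, ∀ w, m ≤ 2 * ((T t w).filter fun q => AgreeFrom t q.2 w).card) :
    2 ^ h * m * (h + 2) ≤ 4 * ∑ w, (T 0 w).card := by
  have hsum : ∀ t ≤ h, 2 ^ h * m ≤
      2 * ∑ w, ((T t w).filter fun q => AgreeFrom t q.2 w).card := by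
    intro t ht
    rw [Finset.mul_sum]
    calc 2 ^ h * m = ∑ _w : Fin h → Bool, m := by simp
      _ ≤ _ := Finset.sum_le_sum fun w _ => hcard t ht w
  have hmono0 : ∀ t w, T t w ⊆ T 0 w := by
    intro t w
    induction t with
    | zero => exact subset_rfl
    | succ t ih => exact (hmono t w).trans ih
  have key : ∀ t ≤ h, 2 ^ h * m * (t + 2) ≤
      4 * ∑ w, ((T 0 w).filter fun q => AgreeFrom t q.2 w).card := by
    intro t
    induction t with
    | zero =>
      intro _
      -- The base case, half of `m` per label, accounts for the `2` in `t + 2`.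
      have := hsum 0 (Nat.zero_le _)
      omega
    | succ t ih =>
      intro ht
      have h1 := ih (by omega)
      have h2 := hsum (t + 1) ht
      -- Now `h2` says that at least `m / 4` elements per label are on average lost when bit `t` is
      -- revealed.
      rw [sum_card_disagree ht (T (t + 1)) (hT (t + 1) ht)] at h2
      have h3 : ∑ w, ((T (t + 1) w).filter fun q =>
            AgreeFrom (t + 1) q.2 w ∧ ¬ q.2 ⟨t, ht⟩ = w ⟨t, ht⟩).card ≤
          ∑ w, ((T 0 w).filter fun q =>
            AgreeFrom (t + 1) q.2 w ∧ ¬ q.2 ⟨t, ht⟩ = w ⟨t, ht⟩).card :=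
        Finset.sum_le_sum fun w _ =>
          Finset.card_le_card (Finset.filter_subset_filter _ (hmono0 _ w))
      -- The lost elements are disjoint from those that still agree from `t` on, so the gains add
      -- up.
      have h4 : ∑ w, ((T 0 w).filter fun q => AgreeFrom (t + 1) q.2 w).card =
          ∑ w, ((T 0 w).filter fun q => AgreeFrom t q.2 w).card +
          ∑ w, ((T 0 w).filter fun q =>
            AgreeFrom (t + 1) q.2 w ∧ ¬ q.2 ⟨t, ht⟩ = w ⟨t, ht⟩).card := by
        rw [← Finset.sum_add_distrib]
        refine Finset.sum_congr rfl fun w _ => ?_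
        simp only [AgreeFrom.succ_iff ht]
        rw [← Finset.filter_filter, ← Finset.filter_filter, Finset.card_filter_add_card_filter_not]
      rw [h4]
      have h5 : 2 ^ h * m * (t + 1 + 2) = 2 ^ h * m * (t + 2) + 2 ^ h * m := by ring
      omega
  refine (key h le_rfl).trans (Nat.mul_le_mul_left _ (Finset.sum_le_sum fun w _ => ?_))
  exact Finset.card_le_card (Finset.filter_subset _ _)

end Flip

/-! ### Request sequences from coarse to fine -/

section Sequence

variable {h : ℕ} {P : Type}

/-- The nonzero multiples of `2 ^ (h - s)`, by decreasing power of two that divides them. -/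
def dyadicPositions (h : ℕ) : ℕ → List (Fin (2 ^ h + 1))
  | 0 => (List.finRange _).filter fun a => a ≠ 0 ∧ 2 ^ h ∣ a.val
  | s + 1 => dyadicPositions h s ++ (List.finRange _).filter fun a =>
      a ≠ 0 ∧ 2 ^ (h - (s + 1)) ∣ a.val ∧ ¬ 2 ^ (h - s) ∣ a.val

theorem mem_dyadicPositions {s : ℕ} {a : Fin (2 ^ h + 1)} :
    a ∈ dyadicPositions h s ↔ a ≠ 0 ∧ 2 ^ (h - s) ∣ a.val := by
  induction s with
  | zero => simp [dyadicPositions]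
  | succ s ih =>
    have : 2 ^ (h - s) ∣ a.val → 2 ^ (h - (s + 1)) ∣ a.val :=
      fun hd => (pow_dvd_pow 2 (by omega)).trans hd
    simp only [dyadicPositions, List.mem_append, ih, List.mem_filter, List.mem_finRange, true_and,
      decide_eq_true_eq]
    tauto

theorem nodup_dyadicPositions (s : ℕ) : (dyadicPositions h s).Nodup := by
  induction s with
  | zero => exact (List.nodup_finRange _).filter _
  | succ s ih =>
    refine List.nodup_append'.2 ⟨ih, (List.nodup_finRange _).filter _, ?_⟩
    intro a ha ha'
    simp only [List.mem_filter, decide_eq_true_eq] at ha'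
    exact ha'.2.2.2 (mem_dyadicPositions.1 ha).2

/-- Refinement only appends positions, so irrevocability compares the solutions at successive
levels. -/
theorem dyadicPositions_prefix {s r : ℕ} (hsr : s ≤ r) :
    dyadicPositions h s <+: dyadicPositions h r := by
  induction r, hsr using Nat.le_induction with
  | base => exact List.prefix_rfl
  | succ r _ ih => exact ih.trans (List.prefix_append _ _)

theorem toFinset_dyadicPositions : (dyadicPositions h h).toFinset = Finset.univ.erase 0 := by
  ext a
  simp [mem_dyadicPositions]

theorem length_dyadicPositions : (dyadicPositions h h).length = 2 ^ h := by
  rw [← List.toFinset_card_of_nodup (nodup_dyadicPositions h), toFinset_dyadicPositions]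
  simp

/-- The request sequence for the label `w`: the vertices on its path at dyadic positions, coarse
ones first, and then the leaves in `B`. -/
def requestSeq (B : Finset P) (w : Fin h → Bool) : List (DiamondVertex h ⊕ P) :=
  (dyadicPositions h h).map (fun a => .inl (vert a w)) ++ B.toList.map .inr

/-- The vertices other than the root on the path with label `w`. -/
def pathVertices (w : Fin h → Bool) : Finset (DiamondVertex h) :=
  (Finset.univ.erase 0).map ⟨_, vert_injective w⟩

theorem card_pathVertices (w : Fin h → Bool) : (pathVertices w).card = 2 ^ h := by
  simp [pathVertices]

theorem nodup_requestSeq (B : Finset P) (w : Fin h → Bool) : (requestSeq B w).Nodup := by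
  refine List.nodup_append'.2 ⟨?_, ?_, ?_⟩
  · exact (nodup_dyadicPositions h).map fun a b hab => vert_injective w (Sum.inl_injective hab)
  · exact B.nodup_toList.map Sum.inr_injective
  · intro x hx hx'
    obtain ⟨a, -, rfl⟩ := List.mem_map.1 hx
    obtain ⟨b, -, hb⟩ := List.mem_map.1 hx'
    exact absurd hb (by simp)

theorem length_requestSeq (B : Finset P) (w : Fin h → Bool) :
    (requestSeq B w).length = 2 ^ h + B.card := by
  simp [requestSeq, length_dyadicPositions]

theorem toFinset_requestSeq [DecidableEq P] (B : Finset P) (w : Fin h → Bool) :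
    (requestSeq B w).toFinset = (pathVertices w).disjSum B := by
  ext x
  rcases x with x | x
  · simp only [requestSeq, pathVertices, List.mem_toFinset, List.mem_append, List.mem_map,
      mem_dyadicPositions, Finset.inl_mem_disjSum, Finset.mem_map, Finset.mem_erase]
    simp
  · simp [requestSeq]

end Sequence

/-! ### Optimal and online costs on the diamond -/

section Costs

theorem diamondEdge_path_injective {h : ℕ} {P : Type} (w : Fin h → Bool) :
    Function.Injective fun p => diamondEdge P (p, w) :=
  fun _ _ hpq => congrArg Prod.fst (diamondEdge_injective hpq)

variable {h : ℕ} {P : Type} [Fintype P]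

/-- The path with label `w` and the edges to the leaves in `B`. -/
def pathSolution (B : Finset P) (w : Fin h → Bool) : Finset (Sym2 (DiamondVertex h ⊕ P)) :=
  ((Finset.univ.map ⟨_, diamondEdge_path_injective w⟩).disjUnion (B.map ⟨_, leafEdge_injective⟩) (by
      rw [Finset.disjoint_left]
      intro e he he'
      obtain ⟨p, -, rfl⟩ := Finset.mem_map.1 he
      obtain ⟨x, -, hx⟩ := Finset.mem_map.1 he'
      exact leafEdge_ne_diamondEdge _ _ hx))

theorem feasible_pathSolution (B : Finset P) (w : Fin h → Bool) :
    (diamondInstance h P).Feasible (pathSolution B w) ((pathVertices w).disjSum B) := by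
  constructor
  · intro e he
    rcases Finset.mem_disjUnion.1 (Finset.mem_coe.1 he) with he | he
    · obtain ⟨p, -, rfl⟩ := Finset.mem_map.1 he
      exact diamondEdge_mem _
    · obtain ⟨x, -, rfl⟩ := Finset.mem_map.1 he
      exact leafEdge_mem _
  · rintro (x | x) hx
    · obtain ⟨a, -, rfl⟩ := Finset.mem_map.1 (Finset.inl_mem_disjSum.1 hx)
      refine reachable_vert (fun p => ?_) a
      exact Finset.mem_coe.2 (Finset.mem_disjUnion.2 (Or.inl
        (Finset.mem_map.2 ⟨p, Finset.mem_univ _, rfl⟩)))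
    · refine reachable_leaf ?_
      exact Finset.mem_coe.2 (Finset.mem_disjUnion.2 (Or.inr
        (Finset.mem_map.2 ⟨x, Finset.inr_mem_disjSum.1 hx, rfl⟩)))

/-- The leaves add at most `1 ≤ 2 ^ h`; the crude factor `2` keeps the bound independent of the
padding. -/
theorem totalCost_pathSolution_le (B : Finset P) (w : Fin h → Bool) :
    (diamondInstance h P).totalCost (pathSolution B w) ≤ 2 * 2 ^ h := by
  have hB : (B.card : ℝ) * (1 / (Fintype.card P + 1 : ℝ)) ≤ 1 := by
    rw [mul_one_div, div_le_one (by positivity)]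
    have : (B.card : ℝ) ≤ Fintype.card P := by exact_mod_cast B.card_le_univ
    linarith
  have h1 : (1 : ℝ) ≤ 2 ^ h := one_le_pow₀ (by norm_num)
  have : (diamondInstance h P).totalCost (pathSolution B w) =
      2 ^ h + (B.card : ℝ) * (1 / (Fintype.card P + 1 : ℝ)) := by
    rw [SteinerInstance.totalCost, pathSolution, Finset.sum_disjUnion, Finset.sum_map,
      Finset.sum_map]
    simp [cost_diamondEdge, cost_leafEdge]
  linarith

theorem totalCost_nonneg (S : Finset (Sym2 (DiamondVertex h ⊕ P))) :
    0 ≤ (diamondInstance h P).totalCost S :=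
  Finset.sum_nonneg fun e _ => cost_nonneg e

theorem opt_le (B : Finset P) (w : Fin h → Bool) :
    (diamondInstance h P).opt ((pathVertices w).disjSum B) ≤ 2 * 2 ^ h := by
  have hbdd : BddBelow {x : ℝ | ∃ S : Finset (Sym2 (DiamondVertex h ⊕ P)),
      (diamondInstance h P).Feasible S ((pathVertices w).disjSum B) ∧
        x = (diamondInstance h P).totalCost S} := by
    refine ⟨0, ?_⟩
    rintro x ⟨S, -, rfl⟩
    exact totalCost_nonneg S
  exact (csInf_le hbdd ⟨_, feasible_pathSolution B w, rfl⟩).trans (totalCost_pathSolution_le B w)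

/-- A feasible set is nonempty, and `le_cost` bounds its cost away from zero uniformly, as the
infimum requires. -/
theorem opt_pos (B : Finset P) (w : Fin h → Bool) :
    0 < (diamondInstance h P).opt ((pathVertices w).disjSum B) := by
  have hpos : (0 : ℝ) < 1 / (Fintype.card P + 1 : ℝ) := by positivity
  refine lt_of_lt_of_le hpos (le_csInf ⟨_, _, feasible_pathSolution B w, rfl⟩ ?_)
  rintro x ⟨S, hS, rfl⟩
  obtain ⟨y, hy⟩ : (pathVertices w).Nonempty := by
    rw [← Finset.card_pos, card_pathVertices]
    positivity
  have hne : y ≠ root h := by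
    obtain ⟨a, ha, rfl⟩ := Finset.mem_map.1 hy
    exact vert_ne_root (Finset.ne_of_mem_erase ha) w
  have hc := hS.2 (.inl y) (Finset.inl_mem_disjSum.2 hy)
  have hSne : S.Nonempty := by
    rw [Finset.nonempty_iff_ne_empty]
    rintro rfl
    simp only [SteinerInstance.Connects, Finset.coe_empty, SimpleGraph.fromEdgeSet_empty,
      SimpleGraph.reachable_bot] at hc
    exact hne (Sum.inl_injective hc).symm
  obtain ⟨e, he⟩ := hSne
  exact (le_cost e).trans (Finset.single_le_sum (f := (diamondInstance h P).cost)
    (fun e _ => cost_nonneg e) he)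

/-- A deterministic online algorithm pays on average at least `(h + 2) / 4` times the length of
the path. -/
theorem le_sum_totalCost [DecidableEq P] (A : OnlineAlgorithm (diamondInstance h P))
    (B : Finset P) :
    (2 : ℝ) ^ h * (2 ^ h * (h + 2) / 4) ≤
      ∑ w : Fin h → Bool, (diamondInstance h P).totalCost (A.sol (requestSeq B w)) := by
  -- The requests after which exactly the bits from `t` on are revealed; time runs with decreasing
  -- `t`.
  let pre : ℕ → (Fin h → Bool) → List (DiamondVertex h ⊕ P) := fun t w =>
    (dyadicPositions h (h - t)).map fun a => .inl (vert a w)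
  have hpre : ∀ {t s : ℕ} (w : Fin h → Bool), s ≤ t → pre t w <+: pre s w := fun w hst =>
    (dyadicPositions_prefix (by omega)).map _
  have hmonoPart : ∀ {S T : Finset (Sym2 (DiamondVertex h ⊕ P))}, S ⊆ T →
      diamondPart S ⊆ diamondPart T :=
    fun hST q hq => mem_diamondPart.2 (hST (mem_diamondPart.1 hq))
  have key := le_sum_card_of_revealed (m := 2 ^ h) (fun t w => diamondPart (A.sol (pre t w)))
    (fun t w => hmonoPart (A.mono _ _ (hpre w (Nat.le_succ t))))
    (fun t ht v w hvw => by
      have : pre t v = pre t w := by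
        refine List.map_congr_left fun a ha => ?_
        have hd := (mem_dyadicPositions.1 ha).2
        rw [vert_eq_of_agreeFrom (t := t) ((pow_dvd_pow 2 (by omega)).trans hd) hvw]
      rw [this])
    (fun t ht w => by
      refine two_pow_le_card_agreeFrom (A.feasible _).1 ht fun a ha hd => ?_
      refine (A.feasible (pre t w)).2 _ ?_
      rw [List.mem_toFinset]
      refine List.mem_map.2 ⟨a, mem_dyadicPositions.2 ⟨ha, ?_⟩, rfl⟩
      rwa [show h - (h - t) = t by omega])
  have hfin : ∀ w, ((diamondPart (A.sol (pre 0 w))).card : ℝ) ≤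
      (diamondInstance h P).totalCost (A.sol (requestSeq B w)) := fun w =>
    (Nat.cast_le.2 (Finset.card_le_card (hmonoPart (A.mono _ _ (List.prefix_append _ _))))).trans
      (card_diamondPart_le _)
  have hsum := Finset.sum_le_sum fun w (_ : w ∈ Finset.univ) => hfin w
  have key' : (2 : ℝ) ^ h * 2 ^ h * (h + 2) ≤
      4 * ∑ w, ((diamondPart (A.sol (pre 0 w))).card : ℝ) := by exact_mod_cast key
  linarith

end Costs

/-! ### From deterministic to randomized algorithms -/

section Expectation

theorem tsum_map_uniform {α β : Type} [Fintype α] [Nonempty α] (g : α → β) (f : β → ℝ) :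
    ∑' b, (((PMF.uniformOfFintype α).map g) b).toReal * f b =
      (Fintype.card α : ℝ)⁻¹ * ∑ a, f (g a) := by
  classical
  have hb : ∀ b, (((PMF.uniformOfFintype α).map g) b).toReal * f b =
      ∑ a, if b = g a then (Fintype.card α : ℝ)⁻¹ * f (g a) else 0 := by
    intro b
    rw [PMF.map_apply, tsum_fintype, ENNReal.toReal_sum, Finset.sum_mul]
    · refine Finset.sum_congr rfl fun a _ => ?_
      split_ifs with h
      · simp [h]
      · simp
    · intro a _
      split_ifs <;> simp
  simp_rw [hb]
  rw [Summable.tsum_finsetSum, Finset.mul_sum]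
  · refine Finset.sum_congr rfl fun a _ => ?_
    rw [tsum_ite_eq]
  · intro a _
    exact summable_of_hasFiniteSupport ((Set.finite_singleton (g a)).subset fun b hb => by
      by_contra hne
      exact hb (if_neg hne))

variable {V : Type} [DecidableEq V] {I : SteinerInstance V}

/-- On a finite vertex set `sol σ` takes finitely many values, so the cost is bounded, and
measurable fibres suffice. -/
theorem RandomizedAlgorithm.integrable_totalCost [Finite V] (A : RandomizedAlgorithm.{u} I)
    (σ : List V) :
    letI := A.measurableSpace
    Integrable (fun s => I.totalCost ((A.alg s).sol σ)) A.law := by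
  let := A.measurableSpace
  have := A.isProbabilityMeasure
  have : Finite (Sym2 V) := Quot.finite _
  let : MeasurableSpace (Finset (Sym2 V)) := ⊤
  have hm : Measurable fun s => (A.alg s).sol σ :=
    measurable_to_countable' fun S => A.measurable σ S
  obtain ⟨C, hC⟩ := (Set.finite_range fun S => ‖I.totalCost S‖).bddAbove
  refine Integrable.of_bound (C := C) ?_ (Filter.Eventually.of_forall fun s => ?_)
  · exact ((measurable_from_top (f := I.totalCost)).comp hm).aestronglyMeasurable
  · exact hC ⟨_, rfl⟩

/-- A lower bound on the sum of the costs on finitely many request sequences that holds for all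
deterministic algorithms also holds for randomized ones. -/
theorem RandomizedAlgorithm.le_sum_expectedCost [Finite V] {ι : Type} [Fintype ι]
    (σ : ι → List V) {x : ℝ}
    (hx : ∀ A : OnlineAlgorithm I, x ≤ ∑ i, I.totalCost (A.sol (σ i)))
    (A : RandomizedAlgorithm.{u} I) : x ≤ ∑ i, A.expectedCost (σ i) := by
  let := A.measurableSpace
  have := A.isProbabilityMeasure
  calc x = ∫ _s, x ∂A.law := by simp
    _ ≤ ∫ s, ∑ i, I.totalCost ((A.alg s).sol (σ i)) ∂A.law :=
        integral_mono (integrable_const _)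
          (integrable_finsetSum _ fun i _ => A.integrable_totalCost (σ i))
          fun s => hx (A.alg s)
    _ = ∑ i, A.expectedCost (σ i) :=
        integral_finsetSum _ fun i _ => A.integrable_totalCost (σ i)

end Expectation

/-! ### The padded diamond adversary -/

section Adversary

variable {h : ℕ} {P : Type} [Fintype P] [DecidableEq P] {n k Δ₁ Δ₂ : ℕ}

theorem disjSum_sdiff_disjSum {α β : Type} [DecidableEq α] [DecidableEq β] (s s' : Finset α)
    (t t' : Finset β) : s.disjSum t \ s'.disjSum t' = (s \ s').disjSum (t \ t') := by
  ext (x | x) <;> simp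

/-- The adversary that predicts `C` and the leaves in `A`, and requests a random path and the
leaves in `B`. -/
def diamondAdversary (C : Finset (DiamondVertex h)) (A B : Finset P)
    (hn : C.card + A.card = n) (hk : 2 ^ h + B.card = k)
    (h₁ : ∀ w, (C \ pathVertices w).card + (A \ B).card = Δ₁)
    (h₂ : ∀ w, (pathVertices w \ C).card + (B \ A).card = Δ₂) :
    Adversary (DiamondVertex h ⊕ P) n k Δ₁ Δ₂ where
  prediction := C.disjSum A
  requests := (PMF.uniformOfFintype (Fin h → Bool)).map (requestSeq B)
  card_prediction := by rw [Finset.card_disjSum, hn]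
  nodup := by
    rw [PMF.support_map]
    rintro _ ⟨w, -, rfl⟩
    exact nodup_requestSeq B w
  length_requests := by
    rw [PMF.support_map]
    rintro _ ⟨w, -, rfl⟩
    rw [length_requestSeq, hk]
  card_sdiff_requests := by
    rw [PMF.support_map]
    rintro _ ⟨w, -, rfl⟩
    rw [toFinset_requestSeq, disjSum_sdiff_disjSum, Finset.card_disjSum, h₁]
  card_requests_sdiff := by
    rw [PMF.support_map]
    rintro _ ⟨w, -, rfl⟩
    rw [toFinset_requestSeq, disjSum_sdiff_disjSum, Finset.card_disjSum, h₂]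

/-- Against the diamond adversary, every randomized algorithm has competitive ratio at least
`(h + 2) / 8`. -/
theorem diamondAdversary_ratio (C : Finset (DiamondVertex h)) (A B : Finset P)
    (hn : C.card + A.card = n) (hk : 2 ^ h + B.card = k)
    (h₁ : ∀ w, (C \ pathVertices w).card + (A \ B).card = Δ₁)
    (h₂ : ∀ w, (pathVertices w \ C).card + (B \ A).card = Δ₂) :
    ∃ adv : Adversary (DiamondVertex h ⊕ P) n k Δ₁ Δ₂,
      (∀ σ ∈ adv.requests.support, 0 < (diamondInstance h P).opt σ.toFinset) ∧
      ∀ x : ℝ, x ≤ (h + 2) / 8 → ∀ alg : RandomizedAlgorithm.{u} (diamondInstance h P),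
        x * adv.expect (fun σ => (diamondInstance h P).opt σ.toFinset) ≤
          adv.expect (fun σ => alg.expectedCost σ) := by
  refine ⟨diamondAdversary C A B hn hk h₁ h₂, ?_, fun x hx alg => ?_⟩
  · rw [diamondAdversary, PMF.support_map]
    rintro _ ⟨w, -, rfl⟩
    rw [toFinset_requestSeq]
    exact opt_pos B w
  · have halg := RandomizedAlgorithm.le_sum_expectedCost (requestSeq B)
      (fun D => le_sum_totalCost D B) alg
    simp only [Adversary.expect, diamondAdversary]
    rw [tsum_map_uniform, tsum_map_uniform, mul_left_comm]
    refine mul_le_mul_of_nonneg_left ?_ (by positivity)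
    refine le_trans ?_ halg
    simp only [toFinset_requestSeq]
    have hopt : ∑ w : Fin h → Bool, (diamondInstance h P).opt ((pathVertices w).disjSum B) ≤
        2 ^ h * (2 * 2 ^ h) := by
      refine (Finset.sum_le_sum fun w _ => opt_le B w).trans ?_
      simp
    have hopt0 : 0 ≤ ∑ w : Fin h → Bool, (diamondInstance h P).opt ((pathVertices w).disjSum B) :=
      Finset.sum_nonneg fun w _ => (opt_pos B w).le
    calc x * _ ≤ ((h + 2) / 8 : ℝ) * _ := mul_le_mul_of_nonneg_right hx hopt0
      _ ≤ ((h + 2) / 8 : ℝ) * (2 ^ h * (2 * 2 ^ h)) :=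
          mul_le_mul_of_nonneg_left hopt (by positivity)
      _ = (2 : ℝ) ^ h * (2 ^ h * (h + 2) / 4) := by ring

end Adversary

/-! ### Placing the diamond relative to the prediction -/

section Parameters

variable {h n k Δ₁ Δ₂ : ℕ}

/-- The conclusion of the lower bound for given parameters and a given bound on the ratio. -/
def HasLowerBound (n k Δ₁ Δ₂ : ℕ) (x : ℝ) : Prop :=
  ∃ (V : Type) (_ : Fintype V) (_ : DecidableEq V) (I : SteinerInstance V)
    (adv : Adversary V n k Δ₁ Δ₂),
    (0 < k → ∀ σ ∈ adv.requests.support, 0 < I.opt σ.toFinset) ∧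
    ∀ A : RandomizedAlgorithm.{u} I,
      x * adv.expect (fun σ => I.opt σ.toFinset) ≤ adv.expect (fun σ => A.expectedCost σ)

/-- A diamond outside of the prediction. -/
theorem hasLowerBound_unpredicted (a : ℕ) {x : ℝ} (hx : x ≤ (h + 2) / 8) (hh : 2 ^ h ≤ Δ₂)
    (hn : n = a + Δ₁) (hk : k = a + Δ₂) : HasLowerBound.{u} n k Δ₁ Δ₂ x := by
  obtain ⟨adv, h1, h2⟩ := diamondAdversary_ratio.{u} (h := h) (n := n) (k := k) (Δ₁ := Δ₁)
    -- Three groups of leaves: predicted and requested, only predicted, only requested.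
    (Δ₂ := Δ₂) (P := Fin a ⊕ Fin Δ₁ ⊕ Fin (Δ₂ - 2 ^ h)) ∅
    (Finset.univ.disjSum (Finset.univ.disjSum ∅)) (Finset.univ.disjSum (Finset.disjSum ∅ Finset.univ))
    (by simp [Finset.card_disjSum, hn]) (by simp [Finset.card_disjSum]; omega)
    (fun w => by
      simp only [disjSum_sdiff_disjSum, Finset.card_disjSum]
      simp)
    (fun w => by
      simp only [disjSum_sdiff_disjSum, Finset.card_disjSum, card_pathVertices, Finset.sdiff_empty]
      simp
      omega)
  exact ⟨_, inferInstance, inferInstance, _, adv, fun _ => h1, h2 x hx⟩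

/-- A diamond inside of the prediction. -/
theorem hasLowerBound_predicted (a : ℕ) {x : ℝ} (hx : x ≤ (h + 2) / 8) (hh : 2 ^ h ≤ a)
    (hh₁ : 4 ^ h ≤ Δ₁ + 1) (hn : n = a + Δ₁) (hk : k = a + Δ₂) :
    HasLowerBound.{u} n k Δ₁ Δ₂ x := by
  have hsub : ∀ w, pathVertices w ⊆ Finset.univ.erase (root h) := by
    intro w y hy
    obtain ⟨b, hb, rfl⟩ := Finset.mem_map.1 hy
    exact Finset.mem_erase.2 ⟨vert_ne_root (Finset.ne_of_mem_erase hb) w, Finset.mem_univ _⟩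
  have hC : (Finset.univ.erase (root h)).card + 1 = Fintype.card (DiamondVertex h) := by
    rw [Finset.card_erase_add_one (Finset.mem_univ _), Finset.card_univ]
  have hC₁ : 2 ^ h ≤ (Finset.univ.erase (root h)).card := by
    have := Finset.card_le_card (hsub fun _ => false)
    rwa [card_pathVertices] at this
  -- The path accounts for `2 ^ h` of the predicted diamond vertices; at most `4 ^ h - 1` others
  -- remain, which `Δ₁` can absorb.
  have hC₂ : (Finset.univ.erase (root h)).card ≤ Δ₁ + 2 ^ h := by
    have h1 := card_le (h := h)
    have h2 : (2 ^ h + 1) * 2 ^ h = 4 ^ h + 2 ^ h := by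
      rw [show (4 : ℕ) = 2 * 2 by norm_num, mul_pow]; ring
    omega
  obtain ⟨adv, h1, h2⟩ := diamondAdversary_ratio.{u} (h := h) (n := n) (k := k) (Δ₁ := Δ₁)
    (Δ₂ := Δ₂) (P := Fin (a - 2 ^ h) ⊕
      Fin (Δ₁ + 2 ^ h - (Finset.univ.erase (root h)).card) ⊕ Fin Δ₂)
    (Finset.univ.erase (root h))
    (Finset.univ.disjSum (Finset.univ.disjSum ∅)) (Finset.univ.disjSum (Finset.disjSum ∅ Finset.univ))
    (by
      simp only [Finset.card_disjSum, Finset.card_fin, Finset.card_empty]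
      omega)
    (by
      simp only [Finset.card_disjSum, Finset.card_fin, Finset.card_empty]
      omega)
    (fun w => by
      simp only [disjSum_sdiff_disjSum, Finset.card_disjSum, sdiff_self, Finset.sdiff_empty,
        Finset.card_sdiff_of_subset (hsub w), card_pathVertices, Finset.card_fin,
        Finset.bot_eq_empty, Finset.empty_sdiff, Finset.card_empty]
      omega)
    (fun w => by
      simp only [disjSum_sdiff_disjSum, Finset.card_disjSum, sdiff_self, Finset.sdiff_empty,
        Finset.sdiff_eq_empty_iff_subset.2 (hsub w), Finset.card_fin,
        Finset.bot_eq_empty, Finset.empty_sdiff, Finset.card_empty]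
      omega)
  exact ⟨_, inferInstance, inferInstance, _, adv, fun _ => h1, h2 x hx⟩

/-- Without requests there is nothing to show. -/
theorem hasLowerBound_zero (n : ℕ) : HasLowerBound.{u} n 0 n 0 0 := by
  let I := diamondInstance 0 (Fin n)
  refine ⟨_, inferInstance, inferInstance, I,
    ⟨Finset.univ.map ⟨Sum.inr, Sum.inr_injective⟩, PMF.pure [], by simp, ?_, ?_, ?_, ?_⟩,
    fun h0 => absurd h0 (lt_irrefl 0), fun A => ?_⟩
  · simp
  · simp
  · simp
  · simp
  · rw [zero_mul]
    refine tsum_nonneg fun σ => mul_nonneg ENNReal.toReal_nonneg ?_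
    exact integral_nonneg fun s => totalCost_nonneg _

end Parameters

/-! ### The constant and the choice of depth -/

/-- Logarithms of numbers below `2 * 4 ^ (h + 1)`. -/
theorem log_le_of_le_two_mul_four_pow {q h : ℕ} (hq : q ≤ 2 * 4 ^ (h + 1)) :
    1 / 24 * Real.log (q : ℝ) ≤ (h + 2) / 8 := by
  rcases Nat.eq_zero_or_pos q with rfl | hpos
  · simp only [Nat.cast_zero, Real.log_zero, mul_zero]
    positivity
  · have h1 : Real.log (q : ℝ) ≤ Real.log ((2 : ℝ) ^ (2 * h + 3)) := by
      refine Real.log_le_log (by exact_mod_cast hpos) ?_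
      calc (q : ℝ) ≤ ((2 * 4 ^ (h + 1) : ℕ) : ℝ) := by exact_mod_cast hq
        _ = (2 : ℝ) ^ (2 * h + 3) := by
            push_cast
            rw [show (4 : ℝ) = 2 ^ 2 by norm_num, ← pow_mul, ← pow_succ']
            congr 1
    rw [Real.log_pow] at h1
    push_cast at h1
    have h2 : Real.log 2 ≤ 1 := by linarith [Real.log_two_lt_d9]
    have h3 : (2 * h + 3 : ℝ) * Real.log 2 ≤ (2 * h + 3) * 1 :=
      mul_le_mul_of_nonneg_left h2 (by positivity)
    -- The constant works since `2 * h + 3 ≤ 3 * (h + 2)`.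
    linarith

end

theorem mainTheorem6 :
    ∃ c : ℝ, 0 < c ∧
      ∀ n k Δ₁ Δ₂ : ℕ, Δ₁ ≤ n → Δ₂ ≤ k → n - Δ₁ = k - Δ₂ →
        ∃ (V : Type) (_ : Fintype V) (_ : DecidableEq V) (I : SteinerInstance V)
          (adv : Adversary V n k Δ₁ Δ₂),
          (0 < k → ∀ σ ∈ adv.requests.support, 0 < I.opt σ.toFinset) ∧
          ∀ A : RandomizedAlgorithm.{u} I,
            c * Real.log ((min k (Δ₁ + Δ₂) : ℕ) : ℝ) *
                adv.expect (fun σ => I.opt σ.toFinset) ≤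
              adv.expect (fun σ => A.expectedCost σ) := by
  refine ⟨1 / 24, by norm_num, fun n k Δ₁ Δ₂ hn hk hm => ?_⟩
  change HasLowerBound.{u} n k Δ₁ Δ₂ _
  rcases Nat.eq_zero_or_pos k with rfl | hkpos
  · obtain rfl : Δ₂ = 0 := by omega
    obtain rfl : n = Δ₁ := by omega
    -- Here the factor is `Real.log 0 = 0`.
    simpa using hasLowerBound_zero.{u} n
  by_cases hcase : 0 < Δ₂ ∧ min k (Δ₁ + Δ₂) ≤ 2 * Δ₂
  · refine hasLowerBound_unpredicted (h := Nat.log 2 Δ₂) (n - Δ₁)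
      (log_le_of_le_two_mul_four_pow ?_) (Nat.pow_log_le_self 2 (by omega)) (by omega) (by omega)
    have h1 := Nat.lt_pow_succ_log_self (b := 2) (by norm_num) Δ₂
    have h2 : 2 ^ (Nat.log 2 Δ₂).succ ≤ 4 ^ (Nat.log 2 Δ₂).succ :=
      Nat.pow_le_pow_left (by norm_num) _
    rw [Nat.succ_eq_add_one] at h1 h2
    omega
  -- With `a = n - Δ₁`, either `Δ₂ = 0` or both `Δ₁` and `a` exceed `Δ₂`. Hence `a` is positive and
  -- `min k (Δ₁ + Δ₂) ≤ 2 * min Δ₁ a`. Using `Δ₁ + 1` keeps the argument of `Nat.log` nonzero when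
  -- `Δ₁ = 0`.
  · have h1 := Nat.lt_pow_succ_log_self (b := 4) (by norm_num) (min (Δ₁ + 1) (n - Δ₁))
    have h2 := Nat.pow_log_le_self 4 (x := min (Δ₁ + 1) (n - Δ₁)) (by omega)
    have h3 : 2 ^ Nat.log 4 (min (Δ₁ + 1) (n - Δ₁)) ≤ 4 ^ Nat.log 4 (min (Δ₁ + 1) (n - Δ₁)) :=
      Nat.pow_le_pow_left (by norm_num) _
    rw [Nat.succ_eq_add_one] at h1
    exact hasLowerBound_predicted (h := Nat.log 4 (min (Δ₁ + 1) (n - Δ₁))) (n - Δ₁)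
      (log_le_of_le_two_mul_four_pow (by omega)) (by omega) (by omega) (by omega) (by omega)
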